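/- **Setting.** Let $k\ge 1$ and $M_k=(i\mathfrak u(k)\oplus\mathbb C^k)\otimes_{\mathbb R}\mathbb H$, with elements $(T,P)$. Identify $\mathbb R^4$ with $\mathbb H$ by $x\mapsto x_1 i+x_2 j+x_3 k+x_4$, let $\mathbb H\otimes\mathbb C=M_2(\mathbb C)$ act on $\mathbb C^2$, and let $*$ be the Hermitian adjoint (complex adjoint tensored with quaternionic conjugation). For $(x,T,P)\in\mathbb R^4\times M_k$ put $$R=R_{(x,T,P)}=\big((T-x\,1)^*,\,P\big):\ \mathbb C^k\otimes\mathbb C^2\oplus\mathbb C^2\to\mathbb C^k\otimes\mathbb C^2 ,\qquad F=(RR^*)^{-1},\qquad \varpi=1-R^*FR .$$ Where $R$ is surjective, $\varpi$ is the orthogonal projection onto the fibre $\ker R$ of the universal bundle, and the connection $\varpi\circ\hat d$ on it has curvature $\varpi\,(dR^*\wedge F\,dR)\,\varpi$. For $\xi\in\mathfrak u(k)$ let $L(\xi)=\mathrm{diag}(\xi\otimes 1,0)$. The equivariant universal second Chern form is the inhomogeneous form (degrees $4,2,0$, of orders $0,1,2$ in $\xi$) $$c^k(\xi)=\frac1{8\pi^2}\,\mathrm{tr}_{\mathbb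 C}\Big[\big((dR^*\wedge F\,dR-L(\xi))\,\varpi\big)^2\Big]$$ ($\tfrac12\mathrm{tr}_{\mathbb C}$ is the quaternionic real part of the trace). For given $(T,P)$ it is defined for almost every $x$; $c^0=0$. Let $\mathrm{Sing}_1^k\subset M_k$ be the linear subspace of zeros of the vector field $(T,P)\mapsto([\xi_1',T],\xi_1'P)$, where $\xi_1'=\mathrm{diag}(i,0,\dots,0)$. It consists of the pairs $$T=\begin{pmatrix}T_0&0\\0&T_1\end{pmatrix},\quad P=\begin{pmatrix}0\\P_1\end{pmatrix},\qquad T_0\in\mathbb H,\ (T_1,P_1)\in M_{k-1}.$$ Let $\iota_1:\mathrm{Sing}_1^k\hookrightarrow M_k$ be the inclusion (and also the induced inclusion into $\mathbb R^4\times M_k$). For $\rho>0$ let $c^k_\rho(\xi)$ be given by the same formula as $c^k(\xi)$ with $F$ replaced by $F_\rho=(RR^*+\rho^2E_{11}\otimes 1)^{-1}$, and $\varpi$ by $1-R^*F_\rho R$. At points of $\mathbb R^4\times\mathrm{Sing}_1^k$ this replaces the entry $|x-T_0|^{-2}$ of $F$ by $(\rho^2+|x-T_0|^2)^{-1}$.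 **Statement.** Let $(T,P)\in\mathrm{Sing}_1^k$ with components $T_0,T_1,P_1$, let $\xi=\mathrm{diag}(\xi_{11},\dots,\xi_{kk})$ with $\xi_{jj}\in i\mathbb R$, and let $\xi_1=\mathrm{diag}(\xi_{22},\dots,\xi_{kk})$. 1. If $x\ne T_0$ and $R_{(x,T_1,P_1)}$ is surjective, then $R_{(x,T,P)}$ is surjective, $\iota_1^*c^k_{(x,T,P)}(\xi)=c^{k-1}_{(x,T_1,P_1)}(\xi_1)$, and $\iota_1^*c^k_{\rho,(x,T,P)}(\xi)\to\iota_1^*c^k_{(x,T,P)}(\xi)$ as $\rho\to0^+$. 2. Define $\iota_1^*c^k_{(x,T,P)}(\xi)$ as a distribution in $x\in\mathbb R^4$, with values in the inhomogeneous forms on $\mathbb R^4\times\mathrm{Sing}_1^k$ (coefficientwise, $(T,P)$ fixed), by $\lim_{\rho\to0^+}\iota_1^*c^k_\rho(\xi)$. Then $$\iota_1^*c^k_{(x,T,P)}(\xi)=c^{k-1}_{(x,T_1,P_1)}(\xi_1)+\delta(x-T_0)\,d(x-T_0)_1\wedge d(x-T_0)_2\wedge d(x-T_0)_3\wedge d(x-T_0)_4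 .$$ Explicitly, let $n\ge 0$, let $a=(a_1,\dots,a_n)$ be vectors tangent to $\mathbb R^4\times\mathrm{Sing}_1^k$, let $a'$ be their images under $(x,T,P)\mapsto(x,T_1,P_1)$, and let $f\in C_c^\infty(\mathbb R^4)$ be such that $f\cdot c^{k-1}_{(\cdot,T_1,P_1)}(\xi_1)(a')$ is integrable. Then $f\cdot c^k_{\rho,(\cdot,T,P)}(\xi)(a)$ is integrable for every $\rho>0$, and $$\lim_{\rho\to0^+}\int_{\mathbb R^4}f(x)\,c^k_{\rho,(x,T,P)}(\xi)(a)\,dx=\int_{\mathbb R^4}f(x)\,c^{k-1}_{(x,T_1,P_1)}(\xi_1)(a')\,dx+f(T_0)\,\big(d(x-T_0)_1\wedge\dots\wedge d(x-T_0)_4\big)(a),$$ where the last term is $0$ unless $n=4$. 3. If $R_{(x,T_1,P_1)}$ is surjective for every $x\in\mathbb R^4$, then the coefficients of $c^{k-1}_{(\cdot,T_1,P_1)}(\xi_1)$ are locally integrable, so that the formula in 2 holds for all $f\in C_c^\infty(\mathbb R^4)$. -/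

import Mathlib

open scoped Kronecker ContDiff Topology
open MeasureTheory Filter

noncomputable section

/-- The base `ℝ⁴`, identified with the quaternions by
`x ↦ x₁ i + x₂ j + x₃ k + x₄` (the coordinates `x₁, …, x₄` are `x 0, …, x 3`). -/
abbrev R4 := EuclideanSpace ℝ (Fin 4)

/-- The quaternion units `i, j, k, 1`, in this order, as complex `2 × 2` matrices: the standard
isomorphism of `ℍ ⊗ ℂ` with the `2 × 2` matrices.  Complex conjugation tensored with quaternionic
conjugation becomes the conjugate transpose. -/
def quatUnit : Fin 4 → Matrix (Fin 2) (Fin 2) ℂ :=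
  ![!![Complex.I, 0; 0, -Complex.I], !![0, 1; -1, 0], !![0, Complex.I; Complex.I, 0], 1]

/-- The space `(i𝔲(k) ⊕ ℂᵏ) ⊗_ℝ ℍ` of pairs `(T, P)`; an element of `V ⊗_ℝ ℍ` is given by its four
components in `V` with respect to the units `i, j, k, 1`. -/
abbrev ADHMData (k : ℕ) :=
  (Fin 4 → selfAdjoint (Matrix (Fin k) (Fin k) ℂ)) × (Fin 4 → Fin k → ℂ)

/-- The vector space `ℝ⁴ × M_k`.  Its elements serve as points `(x, T, P)` and as
tangent vectors. -/
abbrev ADHMTotal (k : ℕ) := R4 × ADHMData k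

/-- The operator `R_x = ((T - x)^*, P) : ℂᵏ ⊗ ℂ² ⊕ ℂ² → ℂᵏ ⊗ ℂ²`.  It depends `ℝ`-linearly on
`(x, T, P)`, so its differential in the direction `a` is `adhmR a`. -/
def adhmR {k : ℕ} (p : ADHMTotal k) :
    Matrix (Fin k × Fin 2) ((Fin k × Fin 2) ⊕ Fin 2) ℂ :=
  Matrix.fromCols
    (∑ i, ((p.2.1 i : Matrix (Fin k) (Fin k) ℂ) - ((p.1 i : ℝ) : ℂ) • 1) ⊗ₖ quatUnit i).conjTranspose
    (Matrix.of fun r c => ∑ i, p.2.2 i r.1 * quatUnit i r.2 c)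

/-- `R_x` is surjective at the point `(x, T, P)`. -/
def NondegenerateAt {k : ℕ} (p : ADHMTotal k) : Prop :=
  Function.Surjective (adhmR p).mulVec

/-- `(R R^* + N)⁻¹`; the Green's operator `(R R^*)⁻¹` is the case `N = 0`, and a nonzero `N` is a
regularisation. -/
def greenOp {k : ℕ} (N : Matrix (Fin k) (Fin k) ℂ) (p : ADHMTotal k) :
    Matrix (Fin k × Fin 2) (Fin k × Fin 2) ℂ :=
  (adhmR p * (adhmR p).conjTranspose + N ⊗ₖ (1 : Matrix (Fin 2) (Fin 2) ℂ))⁻¹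

/-- `1 - R^* (R R^* + N)⁻¹ R`; for `N = 0` and `R` surjective this is the orthogonal projection
onto the fibre `ker R` of the universal bundle, that is `v v^*` for any orthonormal frame `v`. -/
def kerProj {k : ℕ} (N : Matrix (Fin k) (Fin k) ℂ) (p : ADHMTotal k) :
    Matrix ((Fin k × Fin 2) ⊕ Fin 2) ((Fin k × Fin 2) ⊕ Fin 2) ℂ :=
  1 - (adhmR p).conjTranspose * greenOp N p * adhmR p

theorem adhmR_line {k : ℕ} (p a : ADHMTotal k) (t : ℝ) :
    adhmR (p + t • a) = adhmR p + t • adhmR a := by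
  rw [adhmR, adhmR, adhmR]
  ext r (c | c)
  · simp only [Matrix.fromCols_apply_inl, Matrix.conjTranspose_apply, Matrix.sum_apply,
      Matrix.add_apply, Matrix.smul_apply, Matrix.kroneckerMap_apply, Matrix.sub_apply,
      Prod.fst_add, Prod.snd_add, Prod.smul_fst, Prod.smul_snd, Pi.add_apply, Pi.smul_apply,
      AddSubgroup.coe_add, selfAdjoint.val_smul, PiLp.add_apply, PiLp.smul_apply, star_sum,
      Finset.smul_sum, ← Finset.sum_add_distrib]
    refine Finset.sum_congr rfl fun i _ => ?_
    simp [Complex.real_smul]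
    ring
  · simp only [Matrix.fromCols_apply_inr, Matrix.of_apply, Matrix.add_apply, Matrix.smul_apply,
      Prod.snd_add, Prod.smul_snd, Pi.add_apply, Pi.smul_apply,
      Finset.smul_sum, ← Finset.sum_add_distrib]
    refine Finset.sum_congr rfl fun i _ => ?_
    simp [Complex.real_smul]
    ring

/-- The curvature of the connection `ϖ ∘ d` on the subbundle `ker R`, namely
`ϖ (∂_a ϖ ∂_b ϖ - ∂_b ϖ ∂_a ϖ) ϖ`, is `ϖ (dR^* ∧ (R R^*)⁻¹ dR) ϖ`. -/
theorem curvature_eq {k : ℕ} (p a b : ADHMTotal k)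
    (h : IsUnit (adhmR p * (adhmR p).conjTranspose)) :
    ∃ wa wb, HasDerivAt (fun t : ℝ => kerProj 0 (p + t • a)) wa 0 ∧
      HasDerivAt (fun t : ℝ => kerProj 0 (p + t • b)) wb 0 ∧
      kerProj 0 p * (wa * wb - wb * wa) * kerProj 0 p =
        kerProj 0 p * ((adhmR a).conjTranspose * greenOp 0 p * adhmR b -
          (adhmR b).conjTranspose * greenOp 0 p * adhmR a) * kerProj 0 p := by
  classical
  have hd := (Matrix.isUnit_iff_isUnit_det _).1 h
  have key : ∀ c : ADHMTotal k, HasDerivAt (fun t : ℝ => kerProj 0 (p + t • c))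
      (-(kerProj 0 p * (adhmR c).conjTranspose * greenOp 0 p * adhmR p)
        - (adhmR p).conjTranspose * greenOp 0 p * adhmR c * kerProj 0 p) 0 := by
    intro c
    let _ : NormedRing (Matrix (Fin k × Fin 2) (Fin k × Fin 2) ℂ) := Matrix.linftyOpNormedRing
    let _ : NormedAlgebra ℝ (Matrix (Fin k × Fin 2) (Fin k × Fin 2) ℂ) :=
      Matrix.linftyOpNormedAlgebra
    let _ : NormedAddCommGroup (Matrix ((Fin k × Fin 2) ⊕ Fin 2) ((Fin k × Fin 2) ⊕ Fin 2) ℂ) :=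
      Matrix.linftyOpNormedAddCommGroup
    let _ : NormedSpace ℝ (Matrix ((Fin k × Fin 2) ⊕ Fin 2) ((Fin k × Fin 2) ⊕ Fin 2) ℂ) :=
      Matrix.linftyOpNormedSpace
    set R := adhmR p with hR
    set A := adhmR c with hA
    set X := R * A.conjTranspose + A * R.conjTranspose with hX
    have hM : HasDerivAt (fun t : ℝ => R * R.conjTranspose + t • X +
        t ^ 2 • (A * A.conjTranspose)) X 0 := by
      have e1 := (hasDerivAt_id (0 : ℝ)).smul_const X
      have e2 := ((hasDerivAt_id (0 : ℝ)).pow 2).smul_const (A * A.conjTranspose)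
      have e3 := (e1.const_add (R * R.conjTranspose)).add e2
      exact HasDerivAt.congr_deriv (by exact e3) (by simp)
    have hM0 : R * R.conjTranspose + (0 : ℝ) • X + (0 : ℝ) ^ 2 • (A * A.conjTranspose) =
        R * R.conjTranspose := by simp
    have hgr : ∀ t : ℝ, greenOp 0 (p + t • c) =
        Ring.inverse (R * R.conjTranspose + t • X + t ^ 2 • (A * A.conjTranspose)) := by
      intro t
      rw [greenOp, adhmR_line, Matrix.nonsing_inv_eq_ringInverse]
      congr 1
      simp only [Matrix.conjTranspose_add, Matrix.conjTranspose_smul, star_trivial, Matrix.add_mul,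
        Matrix.mul_add, Matrix.smul_mul, Matrix.mul_smul, Matrix.zero_kronecker, add_zero, hX,
        smul_add, smul_smul, ← hR, ← hA, pow_two]
      abel
    have hG : HasDerivAt (fun t : ℝ => greenOp 0 (p + t • c))
        (-(greenOp 0 p * X * greenOp 0 p)) 0 := by
      have hu := hasFDerivAt_ringInverse (𝕜 := ℝ) h.unit
      have hv : (h.unit : Matrix (Fin k × Fin 2) (Fin k × Fin 2) ℂ) =
          R * R.conjTranspose + (0 : ℝ) • X + (0 : ℝ) ^ 2 • (A * A.conjTranspose) := by
        rw [hM0, IsUnit.unit_spec]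
      have := HasFDerivAt.comp_hasDerivAt_of_eq (0 : ℝ) hu hM hv
      simp only [hgr]
      have hg : greenOp 0 p = ((h.unit⁻¹ : (Matrix (Fin k × Fin 2) (Fin k × Fin 2) ℂ)ˣ) :
          Matrix (Fin k × Fin 2) (Fin k × Fin 2) ℂ) := by
        rw [← Ring.inverse_unit, IsUnit.unit_spec, ← Matrix.nonsing_inv_eq_ringInverse]
        simp [greenOp, hR]
      refine HasDerivAt.congr_deriv (by exact this) ?_
      rw [hg]
      rfl
    let conj (U V : Matrix (Fin k × Fin 2) ((Fin k × Fin 2) ⊕ Fin 2) ℂ) :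
        Matrix (Fin k × Fin 2) (Fin k × Fin 2) ℂ →ₗ[ℝ]
          Matrix ((Fin k × Fin 2) ⊕ Fin 2) ((Fin k × Fin 2) ⊕ Fin 2) ℂ :=
      { toFun := fun g => U.conjTranspose * g * V
        map_add' := fun g g' => by simp [Matrix.mul_add, Matrix.add_mul]
        map_smul' := fun s g => by simp }
    have hC : ∀ U V : Matrix (Fin k × Fin 2) ((Fin k × Fin 2) ⊕ Fin 2) ℂ,
        HasDerivAt (fun t : ℝ => U.conjTranspose * greenOp 0 (p + t • c) * V)
        (U.conjTranspose * (-(greenOp 0 p * X * greenOp 0 p)) * V) 0 := fun U V =>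
      (LinearMap.toContinuousLinearMap (conj U V)).hasFDerivAt.comp_hasDerivAt (0 : ℝ) hG
    have hid := hasDerivAt_id (0 : ℝ)
    have hall := (((hC R R).add (hid.smul ((hC A R).add (hC R A)))).add
      ((hid.pow 2).smul (hC A A))).const_sub 1
    refine (HasDerivAt.congr_deriv (by exact hall) ?_).congr_of_eventuallyEq (Eventually.of_forall ?_)
    rotate_left
    · intro t
      simp only [kerProj, adhmR_line, ← hR, ← hA, Matrix.conjTranspose_add,
        Matrix.conjTranspose_smul, star_trivial, Matrix.add_mul,
        Matrix.mul_add, Matrix.smul_mul, Matrix.mul_smul, Pi.add_apply, Pi.smul_apply', id,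
        smul_add, smul_smul, pow_two]
      abel
    · simp only [kerProj, ← hR, hX, id, zero_smul, add_zero, one_smul, zero_add, Matrix.sub_mul,
        Matrix.mul_sub, Matrix.one_mul, Matrix.mul_one, Matrix.mul_add, Matrix.add_mul,
        Matrix.neg_mul, Matrix.mul_neg, Matrix.mul_assoc, Pi.add_apply, Pi.pow_apply, smul_add]
      simp
      abel
  have h0 : greenOp 0 p = (adhmR p * (adhmR p).conjTranspose)⁻¹ := by simp [greenOp]
  have h1 : adhmR p * (adhmR p).conjTranspose * greenOp 0 p = 1 := by
    rw [h0, Matrix.mul_nonsing_inv _ hd]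
  have h2 : greenOp 0 p * (adhmR p * (adhmR p).conjTranspose) = 1 := by
    rw [h0, Matrix.nonsing_inv_mul _ hd]
  have h3 : adhmR p * kerProj 0 p = 0 := by
    rw [kerProj, Matrix.mul_sub, Matrix.mul_one, ← Matrix.mul_assoc, ← Matrix.mul_assoc, h1,
      Matrix.one_mul, sub_self]
  have h4 : kerProj 0 p * (adhmR p).conjTranspose = 0 := by
    rw [kerProj, Matrix.sub_mul, Matrix.one_mul, Matrix.mul_assoc, Matrix.mul_assoc, h2,
      Matrix.mul_one, sub_self]
  have h5 : kerProj 0 p * kerProj 0 p = kerProj 0 p := by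
    conv_lhs => enter [1]; rw [kerProj]
    rw [Matrix.sub_mul, Matrix.one_mul, Matrix.mul_assoc, h3, Matrix.mul_zero, sub_zero]
  refine ⟨_, _, key a, key b, ?_⟩
  generalize kerProj 0 p = w at *
  generalize greenOp 0 p = G at *
  generalize adhmR p = R at *
  generalize adhmR a = A at *
  generalize adhmR b = B at *
  have main : ∀ A B : Matrix (Fin k × Fin 2) ((Fin k × Fin 2) ⊕ Fin 2) ℂ,
      w * ((-(w * A.conjTranspose * G * R) - R.conjTranspose * G * A * w) *
        (-(w * B.conjTranspose * G * R) - R.conjTranspose * G * B * w)) * w =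
      w * (A.conjTranspose * G * B) * w := by
    intro A B
    have e1 : w * (-(w * A.conjTranspose * G * R) - R.conjTranspose * G * A * w) =
        -(w * A.conjTranspose * G * R) := by
      rw [Matrix.mul_sub, Matrix.mul_neg]
      simp only [← Matrix.mul_assoc]
      rw [h5, h4]; simp
    have e2 : (-(w * B.conjTranspose * G * R) - R.conjTranspose * G * B * w) * w =
        -(R.conjTranspose * G * B * w) := by
      rw [Matrix.sub_mul, Matrix.neg_mul]
      simp only [Matrix.mul_assoc]
      rw [h5, h3]; simp
    rw [← Matrix.mul_assoc, e1, Matrix.mul_assoc, e2, neg_mul_neg]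
    calc w * A.conjTranspose * G * R * (R.conjTranspose * G * B * w)
        = w * A.conjTranspose * G * (R * R.conjTranspose * G) * B * w := by
          simp only [Matrix.mul_assoc]
      _ = _ := by rw [h1]; simp only [Matrix.mul_assoc, Matrix.one_mul]
  rw [Matrix.mul_sub, Matrix.sub_mul, main, main, Matrix.mul_sub, Matrix.sub_mul]

/-- The generator `L(ξ) = diag(ξ, 0)` of the action of `ξ ∈ 𝔲(k)` on `ℂᵏ ⊗ ℂ² ⊕ ℂ²`. -/
def liftL {k : ℕ} (ξ : Matrix (Fin k) (Fin k) ℂ) :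
    Matrix ((Fin k × Fin 2) ⊕ Fin 2) ((Fin k × Fin 2) ⊕ Fin 2) ℂ :=
  Matrix.fromBlocks (ξ ⊗ₖ (1 : Matrix (Fin 2) (Fin 2) ℂ)) 0 0 0

/-- The inhomogeneous form `(1 / 8π²) tr (((dR^* ∧ G dR) - L(ξ)) ϖ)²` on `ℝ⁴ × M_k`, with
`G = greenOp N` and `ϖ = kerProj N`, evaluated at the point `p` on `n` tangent vectors `a`.
Only the degrees `n = 4, 2, 0` occur: they are the parts of order `0, 1, 2` in `ξ`.
The trace is the complex one, which on `ℍ ⊗ ℂ` is twice the quaternionic real part. -/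
def regChernForm {k : ℕ} (N ξ : Matrix (Fin k) (Fin k) ℂ) (p : ADHMTotal k) :
    (n : ℕ) → (Fin n → ADHMTotal k) → ℂ
  | 0, _ => 1 / (8 * (Real.pi : ℂ) ^ 2) *
      (liftL ξ * kerProj N p * (liftL ξ * kerProj N p)).trace
  | 2, a => 1 / (8 * (Real.pi : ℂ) ^ 2) *
      (-2 * ∑ σ : Equiv.Perm (Fin 2), ((Equiv.Perm.sign σ : ℤ) : ℂ) *
        ((adhmR (a (σ 0))).conjTranspose * greenOp N p * adhmR (a (σ 1)) * kerProj N p *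
          (liftL ξ * kerProj N p)).trace)
  | 4, a => 1 / (8 * (Real.pi : ℂ) ^ 2) *
      ∑ σ : Equiv.Perm (Fin 4), ((Equiv.Perm.sign σ : ℤ) : ℂ) *
        ((adhmR (a (σ 0))).conjTranspose * greenOp N p * adhmR (a (σ 1)) * kerProj N p *
          ((adhmR (a (σ 2))).conjTranspose * greenOp N p * adhmR (a (σ 3)) * kerProj N p)).trace
  | _, _ => 0

/-- The equivariant universal second Chern form `c^k(ξ)`: the equivariant curvature is
`v^* (dR^* ∧ (R R^*)⁻¹ dR - L(ξ)) v` for an orthonormal frame `v` of `ker R`. -/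
def chernForm {k : ℕ} (ξ : Matrix (Fin k) (Fin k) ℂ) (p : ADHMTotal k) (n : ℕ)
    (a : Fin n → ADHMTotal k) : ℂ :=
  regChernForm 0 ξ p n a

/-- The Lie algebra of the maximal torus of `U(k)`: diagonal skew-Hermitian matrices. -/
def lieTorus (k : ℕ) : Set (Matrix (Fin k) (Fin k) ℂ) :=
  {ξ | ξ.IsDiag ∧ ξ.conjTranspose = -ξ}

/-- The set `Sing_1^k`, `k = m + 1`, of zeros of the vector field
`X_ξ(T, P) = ([ξ, T], ξ P)` for the generator `ξ = diag(i, 0, …, 0)`.  It is a linear subspace. -/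
def sing1 (m : ℕ) : Set (ADHMData (m + 1)) :=
  {D | ∀ i, Matrix.single 0 0 Complex.I * (D.1 i : Matrix (Fin (m + 1)) (Fin (m + 1)) ℂ)
        - (D.1 i : Matrix (Fin (m + 1)) (Fin (m + 1)) ℂ) * Matrix.single 0 0 Complex.I = 0 ∧
      (Matrix.single 0 0 Complex.I : Matrix (Fin (m + 1)) (Fin (m + 1)) ℂ).mulVec (D.2 i) = 0}

/-- The quaternion `T₀` in the upper left corner of `T` (its components are diagonal entries of
Hermitian matrices, hence real). -/
def cornerT {m : ℕ} (D : ADHMData (m + 1)) : R4 :=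
  WithLp.toLp 2 fun i => ((D.1 i : Matrix (Fin (m + 1)) (Fin (m + 1)) ℂ) 0 0).re

/-- `(T₁, P₁)`: drop the first row and column of `T` and the first entry of `P`. -/
def tailData {m : ℕ} (D : ADHMData (m + 1)) : ADHMData m :=
  (fun i => ⟨(D.1 i : Matrix (Fin (m + 1)) (Fin (m + 1)) ℂ).submatrix Fin.succ Fin.succ, by
      have h := (D.1 i).2
      rw [selfAdjoint.mem_iff, Matrix.star_eq_conjTranspose] at h ⊢
      rw [Matrix.conjTranspose_submatrix, h]⟩,
    fun i r => D.2 i r.succ)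

/-- `(x, T, P) ↦ (x, T₁, P₁)`. -/
def tailTotal {m : ℕ} (p : ADHMTotal (m + 1)) : ADHMTotal m := (p.1, tailData p.2)

/-- The form `d(x - T₀)₁ ∧ d(x - T₀)₂ ∧ d(x - T₀)₃ ∧ d(x - T₀)₄` on `ℝ⁴ × M_{m+1}`, as an
inhomogeneous form (zero in degrees other than four). -/
def volForm {m : ℕ} : (n : ℕ) → (Fin n → ADHMTotal (m + 1)) → ℝ
  | 4, a => (Matrix.of fun i j : Fin 4 => ((a j).1 - cornerT (a j).2) i).det
  | _, _ => 0

/-- The regularisation at scale `ρ` of `c^{m+1}(ξ)`: in the block of `T₀` the Green's operator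
`|x - T₀|⁻²` is replaced by `(ρ² + |x - T₀|²)⁻¹`. -/
def chernFormReg {m : ℕ} (ρ : ℝ) (ξ : Matrix (Fin (m + 1)) (Fin (m + 1)) ℂ)
    (p : ADHMTotal (m + 1)) (n : ℕ) (a : Fin n → ADHMTotal (m + 1)) : ℂ :=
  regChernForm (Matrix.single 0 0 ((ρ : ℂ) ^ 2)) ξ p n a

end

/-!
Along `Sing_1` everything is a direct sum. For `(T, P)` in `Sing_1` the operator `R` is
`(T₀ - x)^* ⊕ R₁`, where `R₁` belongs to `(x, T₁, P₁)` (`adhmR_eq_fromBlocks`), and the same holds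
for the differentials of `R` along tangent vectors of `Sing_1`. Since `q q^* = |q|²` for a
quaternion `q`, the regularised Green's operator and the regularised projection act on the block
of `T₀` as the scalars `1 / s` and `ρ² / s`, with `s = |x - T₀|² + ρ²`. Hence, wherever `R₁` is
surjective, `c^k_ρ(ξ)` is the sum of `c^{k-1}(ξ₁)` and a contribution `cornerForm` of the block of
`T₀` (`chernFormReg_eq_cornerForm_add`). For `ρ = 0` and `x ≠ T₀` that contribution vanishes,
which gives the pointwise statements.

The contribution is explicit. In degree `0` it is a multiple of `(ρ² / s)²`, which is bounded and
tends to zero off `T₀`. In degree `2` it is the antisymmetrisation of `tr (q_a q_b^*) = 2 ⟨a, b⟩`,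
that is zero. In degree `4` the trace identity `trace_quat_four` shows that only the determinant
survives antisymmetrisation, and the contribution is `(6 / π²) ρ⁴ / s⁴` times the volume form of
`x - T₀`. The function `(6 / π²) (1 + |x|²)⁻⁴` has integral one on `ℝ⁴` (`integral_bubble`), so its
rescalings form an approximate identity, and the limit is the delta function at `T₀`.

The decomposition can be used under the integral sign because `R₁` is surjective for almost every
`x`: on each line in the direction of `x₄`, the matrix `T₁ - x` is singular at finitely many points
only (`ae_nondegenerateAt`).
-/

/-! ### Nondegenerate points -/

open scoped ComplexOrder in
/-- `R` is surjective exactly when the positive semidefinite matrix `R R^*` is invertible. -/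
theorem nondegenerateAt_iff_isUnit {k : ℕ} (p : ADHMTotal k) :
    NondegenerateAt p ↔ IsUnit (adhmR p * (adhmR p).conjTranspose) := by
  classical
  constructor
  · intro h
    obtain ⟨B, hB⟩ := Matrix.mulVec_surjective_iff_exists_right_inverse.1 h
    refine (Matrix.PosDef.mul_conjTranspose_self (A := adhmR p) ?_).isUnit
    intro v w hvw
    have h' : ∀ u, Matrix.vecMul (Matrix.vecMul u (adhmR p)) B = u := fun u => by
      rw [Matrix.vecMul_vecMul, hB, Matrix.vecMul_one]
    rw [← h' v, ← h' w]
    exact congrArg (fun u => Matrix.vecMul u B) hvw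
  · intro h
    refine Matrix.mulVec_surjective_iff_exists_right_inverse.2
      ⟨(adhmR p).conjTranspose * (adhmR p * (adhmR p).conjTranspose)⁻¹, ?_⟩
    rw [← Matrix.mul_assoc,
      Matrix.mul_nonsing_inv _ ((Matrix.isUnit_iff_isUnit_det _).1 h)]

/-! ### The Chern form of a direct sum -/

/-- The expression `tr ((A^* ∧ G A - L) W)²` for a matrix-valued one-form `A`, given by its values
on the tangent vectors, and matrices `G`, `W`, `L`. As in `regChernForm`, wedge products are
antisymmetrised without a normalising factor. -/
noncomputable def traceForm {r c : Type*} [Fintype r] [Fintype c] (G : Matrix r r ℂ)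
    (W L : Matrix c c ℂ) : (n : ℕ) → (Fin n → Matrix r c ℂ) → ℂ
  | 0, _ => (L * W * (L * W)).trace
  | 2, A => -2 * ∑ σ : Equiv.Perm (Fin 2), ((Equiv.Perm.sign σ : ℤ) : ℂ) *
      ((A (σ 0)).conjTranspose * G * A (σ 1) * W * (L * W)).trace
  | 4, A => ∑ σ : Equiv.Perm (Fin 4), ((Equiv.Perm.sign σ : ℤ) : ℂ) *
      ((A (σ 0)).conjTranspose * G * A (σ 1) * W *
        ((A (σ 2)).conjTranspose * G * A (σ 3) * W)).trace
  | _, _ => 0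

theorem regChernForm_eq_traceForm {k : ℕ} (N ξ : Matrix (Fin k) (Fin k) ℂ) (p : ADHMTotal k)
    (n : ℕ) (a : Fin n → ADHMTotal k) :
    regChernForm N ξ p n a = 1 / (8 * (Real.pi : ℂ) ^ 2) *
      traceForm (greenOp N p) (kerProj N p) (liftL ξ) n (fun i => adhmR (a i)) := by
  match n with
  | 0 => rfl
  | 1 => simp [regChernForm, traceForm]
  | 2 => rfl
  | 3 => simp [regChernForm, traceForm]
  | 4 => rfl
  | _ + 5 => simp [regChernForm, traceForm]

theorem traceForm_submatrix {r c r' c' : Type*} [Fintype r] [Fintype c] [Fintype r'] [Fintype c']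
    (e : r' ≃ r) (e' : c' ≃ c) (G : Matrix r r ℂ) (W L : Matrix c c ℂ) (n : ℕ)
    (A : Fin n → Matrix r c ℂ) :
    traceForm (G.submatrix e e) (W.submatrix e' e') (L.submatrix e' e') n
      (fun i => (A i).submatrix e e') = traceForm G W L n A := by
  have ht : ∀ M : Matrix c c ℂ, (M.submatrix e' e').trace = M.trace := fun M => by
    simp only [Matrix.trace, Matrix.diag, Matrix.submatrix_apply]
    exact Equiv.sum_comp e' fun i => M i i
  match n with
  | 0 => simp only [traceForm, Matrix.submatrix_mul_equiv, ht]
  | 1 => rfl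
  | 2 => simp only [traceForm, Matrix.conjTranspose_submatrix, Matrix.submatrix_mul_equiv, ht]
  | 3 => rfl
  | 4 => simp only [traceForm, Matrix.conjTranspose_submatrix, Matrix.submatrix_mul_equiv, ht]
  | _ + 5 => rfl

theorem trace_fromBlocks {c c' : Type*} [Fintype c] [Fintype c'] (A : Matrix c c ℂ)
    (B : Matrix c c' ℂ) (C : Matrix c' c ℂ) (D : Matrix c' c' ℂ) :
    (Matrix.fromBlocks A B C D).trace = A.trace + D.trace := by
  simp [Matrix.trace, Fintype.sum_sum_type]

theorem traceForm_fromBlocks {r c r' c' : Type*} [Fintype r] [Fintype c] [Fintype r'] [Fintype c']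
    (G : Matrix r r ℂ) (W L : Matrix c c ℂ) (G' : Matrix r' r' ℂ) (W' L' : Matrix c' c' ℂ) (n : ℕ)
    (A : Fin n → Matrix r c ℂ) (A' : Fin n → Matrix r' c' ℂ) :
    traceForm (Matrix.fromBlocks G 0 0 G') (Matrix.fromBlocks W 0 0 W')
      (Matrix.fromBlocks L 0 0 L') n (fun i => Matrix.fromBlocks (A i) 0 0 (A' i)) =
      traceForm G W L n A + traceForm G' W' L' n A' := by
  match n with
  | 0 => simp [traceForm, Matrix.fromBlocks_multiply, trace_fromBlocks]
  | 1 => simp [traceForm]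
  | 2 =>
    simp only [traceForm, Matrix.fromBlocks_conjTranspose, Matrix.fromBlocks_multiply,
      Matrix.conjTranspose_zero, Matrix.mul_zero, Matrix.zero_mul, add_zero, zero_add,
      trace_fromBlocks, mul_add, Finset.sum_add_distrib]
  | 3 => simp [traceForm]
  | 4 =>
    simp only [traceForm, Matrix.fromBlocks_conjTranspose, Matrix.fromBlocks_multiply,
      Matrix.conjTranspose_zero, Matrix.mul_zero, Matrix.zero_mul, add_zero, zero_add,
      trace_fromBlocks, mul_add, Finset.sum_add_distrib]
  | _ + 5 => simp [traceForm]

/-! ### Block decomposition along `Sing_1` -/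

/-- The quaternion `v₁ i + v₂ j + v₃ k + v₄` as a complex `2 × 2` matrix. -/
noncomputable def quat (v : R4) : Matrix (Fin 2) (Fin 2) ℂ := ∑ i, ((v i : ℝ) : ℂ) • quatUnit i

/-- `ℂᵏ ⊗ ℂ² = ℂ² ⊕ (ℂᵏ⁻¹ ⊗ ℂ²)`, splitting off the first basis vector of `ℂᵏ`. -/
def rowEquiv (m : ℕ) : Fin (m + 1) × Fin 2 ≃ Fin 2 ⊕ (Fin m × Fin 2) where
  toFun i := Fin.cases (motive := fun _ => Fin 2 ⊕ (Fin m × Fin 2))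
    (Sum.inl i.2) (fun j => Sum.inr (j, i.2)) i.1
  invFun := Sum.elim (fun s => (0, s)) (fun j => (j.1.succ, j.2))
  left_inv := by
    rintro ⟨i, s⟩
    refine Fin.cases ?_ (fun j => ?_) i <;> simp
  right_inv := by
    rintro (s | ⟨j, s⟩) <;> simp

/-- `ℂᵏ ⊗ ℂ² ⊕ ℂ² = ℂ² ⊕ (ℂᵏ⁻¹ ⊗ ℂ² ⊕ ℂ²)`, splitting off the first basis vector of `ℂᵏ`. -/
def colEquiv (m : ℕ) :
    (Fin (m + 1) × Fin 2) ⊕ Fin 2 ≃ Fin 2 ⊕ ((Fin m × Fin 2) ⊕ Fin 2) :=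
  ((rowEquiv m).sumCongr (Equiv.refl _)).trans (Equiv.sumAssoc _ _ _)

@[simp] theorem rowEquiv_zero (m : ℕ) (s : Fin 2) : rowEquiv m (0, s) = Sum.inl s := rfl
@[simp] theorem rowEquiv_succ (m : ℕ) (j : Fin m) (s : Fin 2) :
    rowEquiv m (j.succ, s) = Sum.inr (j, s) := rfl
@[simp] theorem colEquiv_zero (m : ℕ) (s : Fin 2) :
    colEquiv m (Sum.inl (0, s)) = Sum.inl s := rfl
@[simp] theorem colEquiv_succ (m : ℕ) (j : Fin m) (s : Fin 2) :
    colEquiv m (Sum.inl (j.succ, s)) = Sum.inr (Sum.inl (j, s)) := rfl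
@[simp] theorem colEquiv_inr (m : ℕ) (s : Fin 2) :
    colEquiv m (Sum.inr s) = Sum.inr (Sum.inr s) := rfl

/-- The pairs in `Sing_1` are the block diagonal ones. -/
theorem eq_zero_of_mem_sing1 {m : ℕ} {D : ADHMData (m + 1)} (hD : D ∈ sing1 m) (i : Fin 4) :
    (∀ j : Fin m, (D.1 i : Matrix (Fin (m + 1)) (Fin (m + 1)) ℂ) 0 j.succ = 0) ∧
    (∀ j : Fin m, (D.1 i : Matrix (Fin (m + 1)) (Fin (m + 1)) ℂ) j.succ 0 = 0) ∧
    D.2 i 0 = 0 := by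
  obtain ⟨h1, h2⟩ := hD i
  refine ⟨fun j => ?_, fun j => ?_, ?_⟩
  · have h := congrFun (congrFun h1 0) j.succ
    simpa [Matrix.sub_apply, Matrix.mul_apply, Matrix.single_apply, (Fin.succ_ne_zero j).symm]
      using h
  · have h := congrFun (congrFun h1 j.succ) 0
    simpa [Matrix.sub_apply, Matrix.mul_apply, Matrix.single_apply, (Fin.succ_ne_zero j).symm]
      using h
  · have h := congrFun h2 0
    simpa [Matrix.mulVec, dotProduct, Matrix.single_apply] using h

/-- Along `Sing_1` the operator `R` is the direct sum of `(T₀ - x)^*` and the operator of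
`(x, T₁, P₁)`. -/
theorem adhmR_eq_fromBlocks {m : ℕ} (p : ADHMTotal (m + 1)) (hp : p.2 ∈ sing1 m) :
    adhmR p = (Matrix.fromBlocks (quat (cornerT p.2 - p.1)).conjTranspose 0 0
      (adhmR (tailTotal p))).submatrix (rowEquiv m) (colEquiv m) := by
  have h0 := fun i => (eq_zero_of_mem_sing1 hp i).1
  have h1 := fun i => (eq_zero_of_mem_sing1 hp i).2.1
  have h2 := fun i => (eq_zero_of_mem_sing1 hp i).2.2
  have h3 : ∀ i, ((((p.2.1 i : Matrix (Fin (m + 1)) (Fin (m + 1)) ℂ) 0 0).re : ℝ) : ℂ) =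
      (p.2.1 i : Matrix (Fin (m + 1)) (Fin (m + 1)) ℂ) 0 0 := fun i => by
    have h := (p.2.1 i).2
    rw [selfAdjoint.mem_iff, Matrix.star_eq_conjTranspose] at h
    exact Complex.conj_eq_iff_re.1 (congrFun (congrFun h 0) 0)
  ext ⟨r, s⟩ (⟨c, t⟩ | t)
  · refine Fin.cases ?_ (fun r => ?_) r <;> refine Fin.cases ?_ (fun c => ?_) c
    · simp only [adhmR, Matrix.fromCols_apply_inl, Matrix.conjTranspose_apply, Matrix.sum_apply,
        Matrix.kroneckerMap_apply, Matrix.submatrix_apply, rowEquiv_zero, colEquiv_zero,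
        Matrix.fromBlocks_apply₁₁, quat, Matrix.smul_apply, Matrix.sub_apply]
      congr 1
      refine Finset.sum_congr rfl fun i _ => ?_
      simp [cornerT, h3]
    · simp [adhmR, Matrix.sum_apply, h1]
    · simp [adhmR, Matrix.sum_apply, h0, (Fin.succ_ne_zero _).symm]
    · simp [adhmR, Matrix.sum_apply, tailTotal, tailData, Matrix.one_apply]
  · refine Fin.cases ?_ (fun r => ?_) r
    · simp [adhmR, h2]
    · simp [adhmR, tailTotal, tailData]

theorem liftL_eq_fromBlocks {m : ℕ} (ξ : Matrix (Fin (m + 1)) (Fin (m + 1)) ℂ) (hξ : ξ.IsDiag) :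
    liftL ξ = (Matrix.fromBlocks (ξ 0 0 • 1) 0 0
      (liftL (ξ.submatrix Fin.succ Fin.succ))).submatrix (colEquiv m) (colEquiv m) := by
  have h0 : ∀ j : Fin m, ξ 0 j.succ = 0 := fun j => hξ (Fin.succ_ne_zero j).symm
  have h1 : ∀ j : Fin m, ξ j.succ 0 = 0 := fun j => hξ (Fin.succ_ne_zero j)
  ext (⟨r, s⟩ | s) (⟨c, t⟩ | t)
  · refine Fin.cases ?_ (fun r => ?_) r <;> refine Fin.cases ?_ (fun c => ?_) c <;>
      simp [liftL, h0, h1]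
  · refine Fin.cases ?_ (fun r => ?_) r <;> simp [liftL]
  · refine Fin.cases ?_ (fun c => ?_) c <;> simp [liftL]
  · simp [liftL]

theorem single_kronecker_eq_fromBlocks {m : ℕ} (c : ℂ) :
    (Matrix.single 0 0 c : Matrix (Fin (m + 1)) (Fin (m + 1)) ℂ) ⊗ₖ
      (1 : Matrix (Fin 2) (Fin 2) ℂ) =
      (Matrix.fromBlocks (c • 1) 0 0 0).submatrix (rowEquiv m) (rowEquiv m) := by
  ext ⟨r, s⟩ ⟨c, t⟩
  refine Fin.cases ?_ (fun r => ?_) r <;> refine Fin.cases ?_ (fun c => ?_) c <;>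
    simp [(Fin.succ_ne_zero _).symm]

/-- `q^* q = |q|²`: the units multiply as quaternions. -/
theorem quat_conjTranspose_mul_self (v : R4) :
    (quat v).conjTranspose * quat v = ((‖v‖ ^ 2 : ℝ) : ℂ) • 1 := by
  rw [EuclideanSpace.real_norm_sq_eq]
  ext i j
  fin_cases i <;> fin_cases j <;>
    simp [quat, quatUnit, Fin.sum_univ_four, Matrix.mul_apply, Complex.ext_iff, pow_two] <;>
    (constructor <;> ring)

theorem quat_mul_conjTranspose_self (v : R4) :
    quat v * (quat v).conjTranspose = ((‖v‖ ^ 2 : ℝ) : ℂ) • 1 := by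
  rw [EuclideanSpace.real_norm_sq_eq]
  ext i j
  fin_cases i <;> fin_cases j <;>
    simp [quat, quatUnit, Fin.sum_univ_four, Matrix.mul_apply, Complex.ext_iff, pow_two] <;>
    (constructor <;> ring)

theorem adhmR_mul_conjTranspose_add_eq_fromBlocks {m : ℕ} (p : ADHMTotal (m + 1))
    (hp : p.2 ∈ sing1 m) (ρ : ℝ) :
    adhmR p * (adhmR p).conjTranspose +
      (Matrix.single 0 0 ((ρ : ℂ) ^ 2) : Matrix (Fin (m + 1)) (Fin (m + 1)) ℂ) ⊗ₖ
        (1 : Matrix (Fin 2) (Fin 2) ℂ) =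
      (Matrix.fromBlocks (((‖cornerT p.2 - p.1‖ ^ 2 + ρ ^ 2 : ℝ) : ℂ) • 1) 0 0
        (adhmR (tailTotal p) * (adhmR (tailTotal p)).conjTranspose)).submatrix
          (rowEquiv m) (rowEquiv m) := by
  rw [single_kronecker_eq_fromBlocks, adhmR_eq_fromBlocks p hp, Matrix.conjTranspose_submatrix,
    Matrix.submatrix_mul_equiv, Matrix.fromBlocks_conjTranspose, Matrix.fromBlocks_multiply,
    show ∀ A B : Matrix (Fin 2 ⊕ (Fin m × Fin 2)) (Fin 2 ⊕ (Fin m × Fin 2)) ℂ,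
      A.submatrix (rowEquiv m) (rowEquiv m) + B.submatrix (rowEquiv m) (rowEquiv m) =
        (A + B).submatrix (rowEquiv m) (rowEquiv m) from fun _ _ => rfl,
    Matrix.fromBlocks_add]
  simp [quat_conjTranspose_mul_self, add_smul]

theorem NondegenerateAt.of_tail {m : ℕ} {p : ADHMTotal (m + 1)} (hp : p.2 ∈ sing1 m)
    (hx : p.1 ≠ cornerT p.2) (h : NondegenerateAt (tailTotal p)) : NondegenerateAt p := by
  classical
  rw [nondegenerateAt_iff_isUnit] at h ⊢
  have h0 := adhmR_mul_conjTranspose_add_eq_fromBlocks p hp 0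
  have hne : ((‖cornerT p.2 - p.1‖ ^ 2 + 0 ^ 2 : ℝ) : ℂ) ≠ 0 := by
    simpa [sub_eq_zero] using hx.symm
  rw [show (Matrix.single 0 0 (((0 : ℝ) : ℂ) ^ 2) : Matrix (Fin (m + 1)) (Fin (m + 1)) ℂ) = 0 by
    simp, Matrix.zero_kronecker, add_zero] at h0
  rw [h0, Matrix.isUnit_submatrix_equiv, Matrix.isUnit_fromBlocks_zero₂₁]
  exact ⟨((Units.mk0 _ hne) • (1 : (Matrix (Fin 2) (Fin 2) ℂ)ˣ)).isUnit, h⟩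

theorem greenOp_eq_fromBlocks {m : ℕ} (p : ADHMTotal (m + 1)) (hp : p.2 ∈ sing1 m) (ρ : ℝ)
    (hs : ‖cornerT p.2 - p.1‖ ^ 2 + ρ ^ 2 ≠ 0) (h : NondegenerateAt (tailTotal p)) :
    greenOp (Matrix.single 0 0 ((ρ : ℂ) ^ 2)) p =
      (Matrix.fromBlocks (((‖cornerT p.2 - p.1‖ ^ 2 + ρ ^ 2 : ℝ) : ℂ)⁻¹ • 1) 0 0
        (greenOp 0 (tailTotal p))).submatrix (rowEquiv m) (rowEquiv m) := by
  classical
  rw [nondegenerateAt_iff_isUnit] at h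
  have hne : ((‖cornerT p.2 - p.1‖ ^ 2 + ρ ^ 2 : ℝ) : ℂ) ≠ 0 := by exact_mod_cast hs
  rw [greenOp, adhmR_mul_conjTranspose_add_eq_fromBlocks p hp]
  refine Matrix.inv_eq_right_inv ?_
  rw [Matrix.submatrix_mul_equiv, Matrix.fromBlocks_multiply, greenOp, Matrix.zero_kronecker,
    add_zero]
  simp only [Matrix.mul_zero, Matrix.zero_mul, add_zero, zero_add]
  rw [Matrix.mul_nonsing_inv _ ((Matrix.isUnit_iff_isUnit_det _).1 h), Matrix.smul_mul,
    Matrix.one_mul, smul_smul, mul_inv_cancel₀ hne, one_smul, Matrix.fromBlocks_one,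
    Matrix.submatrix_one_equiv]

/-- On the block of `T₀` the projection is the scalar
`1 - |x - T₀|² / (|x - T₀|² + ρ²) = ρ² / (|x - T₀|² + ρ²)`. -/
theorem kerProj_eq_fromBlocks {m : ℕ} (p : ADHMTotal (m + 1)) (hp : p.2 ∈ sing1 m) (ρ : ℝ)
    (hs : ‖cornerT p.2 - p.1‖ ^ 2 + ρ ^ 2 ≠ 0) (h : NondegenerateAt (tailTotal p)) :
    kerProj (Matrix.single 0 0 ((ρ : ℂ) ^ 2)) p =
      (Matrix.fromBlocks (((ρ ^ 2 / (‖cornerT p.2 - p.1‖ ^ 2 + ρ ^ 2) : ℝ) : ℂ) • 1) 0 0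
        (kerProj 0 (tailTotal p))).submatrix (colEquiv m) (colEquiv m) := by
  have hne : ((‖cornerT p.2 - p.1‖ ^ 2 + ρ ^ 2 : ℝ) : ℂ) ≠ 0 := by exact_mod_cast hs
  have e : (1 : Matrix (Fin 2) (Fin 2) ℂ) - ((‖cornerT p.2 - p.1‖ ^ 2 + ρ ^ 2 : ℝ) : ℂ)⁻¹ •
      ((‖cornerT p.2 - p.1‖ ^ 2 : ℝ) : ℂ) • (1 : Matrix (Fin 2) (Fin 2) ℂ) =
      ((ρ ^ 2 / (‖cornerT p.2 - p.1‖ ^ 2 + ρ ^ 2) : ℝ) : ℂ) • 1 := by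
    rw [smul_smul]
    nth_rewrite 1 [← one_smul ℂ (1 : Matrix (Fin 2) (Fin 2) ℂ)]
    rw [← sub_smul]
    congr 1
    push_cast at hne ⊢
    field_simp
    ring
  rw [kerProj, greenOp_eq_fromBlocks p hp ρ hs h, adhmR_eq_fromBlocks p hp,
    Matrix.conjTranspose_submatrix, Matrix.submatrix_mul_equiv, Matrix.submatrix_mul_equiv,
    ← Matrix.submatrix_one_equiv (colEquiv m), ← Matrix.fromBlocks_one,
    Matrix.fromBlocks_conjTranspose, Matrix.fromBlocks_multiply, Matrix.fromBlocks_multiply,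
    show ∀ A B : Matrix (Fin 2 ⊕ ((Fin m × Fin 2) ⊕ Fin 2)) (Fin 2 ⊕ ((Fin m × Fin 2) ⊕ Fin 2)) ℂ,
      A.submatrix (colEquiv m) (colEquiv m) - B.submatrix (colEquiv m) (colEquiv m) =
        (A - B).submatrix (colEquiv m) (colEquiv m) from fun _ _ => rfl,
    sub_eq_add_neg, Matrix.fromBlocks_neg, Matrix.fromBlocks_add, ← e, kerProj]
  simp [quat_mul_conjTranspose_self, sub_eq_add_neg]

/-- The contribution of the block of `T₀` to the regularised Chern form, as a function of
`s = |x - T₀|²`, the entry `c = ξ₁₁` and the tangent quaternions `v`. -/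
noncomputable def cornerForm (ρ s : ℝ) (c : ℂ) (n : ℕ) (v : Fin n → R4) : ℂ :=
  1 / (8 * (Real.pi : ℂ) ^ 2) * traceForm (((s + ρ ^ 2 : ℝ) : ℂ)⁻¹ • 1)
    (((ρ ^ 2 / (s + ρ ^ 2) : ℝ) : ℂ) • 1) (c • 1) n (fun i => (quat (v i)).conjTranspose)

theorem chernFormReg_eq_cornerForm_add {m : ℕ} (p : ADHMTotal (m + 1)) (hp : p.2 ∈ sing1 m)
    (ρ : ℝ) (hs : ‖cornerT p.2 - p.1‖ ^ 2 + ρ ^ 2 ≠ 0) (h : NondegenerateAt (tailTotal p))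
    (ξ : Matrix (Fin (m + 1)) (Fin (m + 1)) ℂ) (hξ : ξ.IsDiag)
    (n : ℕ) (a : Fin n → ADHMTotal (m + 1)) (ha : ∀ i, (a i).2 ∈ sing1 m) :
    chernFormReg ρ ξ p n a =
      cornerForm ρ (‖cornerT p.2 - p.1‖ ^ 2) (ξ 0 0) n (fun i => cornerT (a i).2 - (a i).1) +
      chernForm (ξ.submatrix Fin.succ Fin.succ) (tailTotal p) n (fun i => tailTotal (a i)) := by
  rw [chernFormReg, chernForm, regChernForm_eq_traceForm, regChernForm_eq_traceForm, cornerForm,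
    ← mul_add, ← traceForm_fromBlocks, greenOp_eq_fromBlocks p hp ρ hs h,
    kerProj_eq_fromBlocks p hp ρ hs h, liftL_eq_fromBlocks ξ hξ,
    funext fun i => adhmR_eq_fromBlocks (a i) (ha i)]
  rw [traceForm_submatrix]

/-! ### The trace of the block of `T₀` -/

/-- The antisymmetrisation of a function that is unchanged by a transposition of its arguments
vanishes. -/
theorem sum_sign_mul_eq_zero {n : ℕ} (g : Equiv.Perm (Fin n) → ℂ) (i j : Fin n) (hij : i ≠ j)
    (hg : ∀ σ, g (σ * Equiv.swap i j) = g σ) :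
    ∑ σ : Equiv.Perm (Fin n), ((Equiv.Perm.sign σ : ℤ) : ℂ) * g σ = 0 := by
  have h := Equiv.sum_comp (Equiv.mulRight (Equiv.swap i j))
    (fun σ : Equiv.Perm (Fin n) => ((Equiv.Perm.sign σ : ℤ) : ℂ) * g σ)
  simp only [Equiv.coe_mulRight, hg, Equiv.Perm.sign_mul, Equiv.Perm.sign_swap hij] at h
  simp only [mul_neg, mul_one, Units.val_neg, Int.cast_neg, neg_mul, Finset.sum_neg_distrib] at h
  exact self_eq_neg.1 h.symm

theorem trace_quat_mul_conjTranspose (a b : R4) :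
    (quat a * (quat b).conjTranspose).trace = 2 * ((inner ℝ a b : ℝ) : ℂ) := by
  simp [quat, quatUnit, Fin.sum_univ_four, Matrix.trace_fin_two, Matrix.mul_apply, Complex.ext_iff,
    PiLp.inner_apply]
  constructor <;> ring

/-- Up to terms symmetric under a transposition of two arguments, `tr (a b^* c d^*)` is twice the
determinant; the sign is `i (-j) k = 1`. -/
theorem trace_quat_four (a b c d : R4) :
    (quat a * (quat b).conjTranspose * (quat c * (quat d).conjTranspose)).trace =
      2 * ((inner ℝ a b * inner ℝ c d : ℝ) : ℂ) - 2 * ((inner ℝ a c * inner ℝ b d : ℝ) : ℂ) +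
        2 * ((inner ℝ a d * inner ℝ b c : ℝ) : ℂ) +
        2 * (((Matrix.of ![WithLp.ofLp a, WithLp.ofLp b, WithLp.ofLp c, WithLp.ofLp d] :
          Matrix (Fin 4) (Fin 4) ℝ).det : ℝ) : ℂ) := by
  have hM : ∀ a b : R4, ∃ z w : ℂ, quat a * (quat b).conjTranspose = !![z, w; -star w, star z] ∧
      z = ⟨a 0 * b 0 + a 1 * b 1 + a 2 * b 2 + a 3 * b 3,
        a 0 * b 3 - a 3 * b 0 + a 2 * b 1 - a 1 * b 2⟩ ∧
      w = ⟨a 1 * b 3 - a 3 * b 1 + a 0 * b 2 - a 2 * b 0,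
        a 1 * b 0 - a 0 * b 1 + a 2 * b 3 - a 3 * b 2⟩ := fun a b => by
    refine ⟨_, _, ?_, rfl, rfl⟩
    ext i j
    fin_cases i <;> fin_cases j <;>
      simp [quat, quatUnit, Fin.sum_univ_four, Matrix.mul_apply, Complex.ext_iff] <;>
      (constructor <;> ring)
  obtain ⟨z, w, h, hz, hw⟩ := hM a b
  obtain ⟨z', w', h', hz', hw'⟩ := hM c d
  rw [h, h', Matrix.det_succ_row_zero]
  simp only [Matrix.det_fin_three, Matrix.trace_fin_two, Matrix.mul_apply, Fin.sum_univ_two,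
    PiLp.inner_apply, Fin.sum_univ_four, Complex.ext_iff]
  subst hz hw hz' hw'
  simp [Fin.succAbove, show ((-1 : ℂ) ^ 3) = -1 by norm_num]
  constructor <;> ring

theorem sum_sign_trace_quat_two (v : Fin 2 → R4) :
    ∑ σ : Equiv.Perm (Fin 2), ((Equiv.Perm.sign σ : ℤ) : ℂ) *
      (quat (v (σ 0)) * (quat (v (σ 1))).conjTranspose).trace = 0 := by
  refine sum_sign_mul_eq_zero (fun σ => _) 0 1 (by decide) fun σ => ?_
  simp only [trace_quat_mul_conjTranspose, Equiv.Perm.mul_apply, Equiv.swap_apply_left,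
    Equiv.swap_apply_right]
  rw [real_inner_comm]

theorem sum_sign_trace_quat_four (v : Fin 4 → R4) :
    ∑ σ : Equiv.Perm (Fin 4), ((Equiv.Perm.sign σ : ℤ) : ℂ) *
      (quat (v (σ 0)) * (quat (v (σ 1))).conjTranspose *
        (quat (v (σ 2)) * (quat (v (σ 3))).conjTranspose)).trace =
      48 * (((Matrix.of fun i j => v j i).det : ℝ) : ℂ) := by
  have e01 : ∀ σ : Equiv.Perm (Fin 4), (σ * Equiv.swap 0 1 : Equiv.Perm (Fin 4)) 2 = σ 2 ∧
      (σ * Equiv.swap 0 1 : Equiv.Perm (Fin 4)) 3 = σ 3 := fun σ => ⟨rfl, rfl⟩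
  have e02 : ∀ σ : Equiv.Perm (Fin 4), (σ * Equiv.swap 0 2 : Equiv.Perm (Fin 4)) 1 = σ 1 ∧
      (σ * Equiv.swap 0 2 : Equiv.Perm (Fin 4)) 3 = σ 3 := fun σ => ⟨rfl, rfl⟩
  have e03 : ∀ σ : Equiv.Perm (Fin 4), (σ * Equiv.swap 0 3 : Equiv.Perm (Fin 4)) 1 = σ 1 ∧
      (σ * Equiv.swap 0 3 : Equiv.Perm (Fin 4)) 2 = σ 2 := fun σ => ⟨rfl, rfl⟩
  have h1 := sum_sign_mul_eq_zero (n := 4) (fun σ => 2 * ((inner ℝ (v (σ 0)) (v (σ 1)) *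
      inner ℝ (v (σ 2)) (v (σ 3)) : ℝ) : ℂ)) 0 1 (by decide) fun σ => by
    simp only [e01]
    simp only [Equiv.Perm.mul_apply, Equiv.swap_apply_left, Equiv.swap_apply_right]
    rw [real_inner_comm]
  have h2 := sum_sign_mul_eq_zero (n := 4) (fun σ => 2 * ((inner ℝ (v (σ 0)) (v (σ 2)) *
      inner ℝ (v (σ 1)) (v (σ 3)) : ℝ) : ℂ)) 0 2 (by decide) fun σ => by
    simp only [e02]
    simp only [Equiv.Perm.mul_apply, Equiv.swap_apply_left, Equiv.swap_apply_right]
    rw [real_inner_comm]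
  have h3 := sum_sign_mul_eq_zero (n := 4) (fun σ => 2 * ((inner ℝ (v (σ 0)) (v (σ 3)) *
      inner ℝ (v (σ 1)) (v (σ 2)) : ℝ) : ℂ)) 0 3 (by decide) fun σ => by
    simp only [e03]
    simp only [Equiv.Perm.mul_apply, Equiv.swap_apply_left, Equiv.swap_apply_right]
    rw [real_inner_comm]
  have hdet : ∀ σ : Equiv.Perm (Fin 4), ((Equiv.Perm.sign σ : ℤ) : ℂ) *
      (2 * (((Matrix.of ![WithLp.ofLp (v (σ 0)), WithLp.ofLp (v (σ 1)), WithLp.ofLp (v (σ 2)),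
        WithLp.ofLp (v (σ 3))] : Matrix (Fin 4) (Fin 4) ℝ).det : ℝ) : ℂ)) =
      2 * (((Matrix.of fun i j => v j i).det : ℝ) : ℂ) := fun σ => by
    have hm : (Matrix.of ![WithLp.ofLp (v (σ 0)), WithLp.ofLp (v (σ 1)), WithLp.ofLp (v (σ 2)),
        WithLp.ofLp (v (σ 3))] : Matrix (Fin 4) (Fin 4) ℝ) =
        (Matrix.of fun i j => v j i).transpose.submatrix σ id := by
      ext i j
      fin_cases i <;> rfl
    rw [hm, Matrix.det_permute, Matrix.det_transpose]
    rcases Int.units_eq_one_or (Equiv.Perm.sign σ) with h | h <;> simp [h]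
  simp only [trace_quat_four, mul_add, mul_sub, hdet, Finset.sum_add_distrib,
    Finset.sum_sub_distrib, h1, h2, h3]
  simp only [Finset.sum_const, Finset.card_univ, Fintype.card_perm, Fintype.card_fin]
  norm_num [Nat.factorial]
  ring

theorem cornerForm_zero (ρ s : ℝ) (c : ℂ) (v : Fin 0 → R4) :
    cornerForm ρ s c 0 v =
      1 / (4 * (Real.pi : ℂ) ^ 2) * c ^ 2 * (((ρ ^ 2 / (s + ρ ^ 2)) ^ 2 : ℝ) : ℂ) := by
  simp only [cornerForm, traceForm, Matrix.smul_mul, Matrix.mul_smul, Matrix.one_mul, smul_smul,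
    Matrix.trace_smul, Matrix.trace_one, Fintype.card_fin, smul_eq_mul]
  push_cast
  have : (Real.pi : ℂ) ≠ 0 := by exact_mod_cast Real.pi_ne_zero
  field_simp
  ring

theorem cornerForm_two (ρ s : ℝ) (c : ℂ) (v : Fin 2 → R4) : cornerForm ρ s c 2 v = 0 := by
  have h : ∀ (g w : ℂ) (A B : Matrix (Fin 2) (Fin 2) ℂ),
      (A * (g • 1) * B * (w • 1) * ((c • 1) * (w • 1))).trace = g * w * c * w * (A * B).trace := by
    intro g w A B
    simp only [Matrix.smul_mul, Matrix.mul_smul, Matrix.mul_one, smul_smul,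
      Matrix.trace_smul, smul_eq_mul]
    ring
  simp only [cornerForm, traceForm, Matrix.conjTranspose_conjTranspose, h]
  simp only [mul_left_comm _ (_ * c * _), ← Finset.mul_sum, sum_sign_trace_quat_two, mul_zero]

theorem cornerForm_four (ρ s : ℝ) (c : ℂ) (v : Fin 4 → R4) :
    cornerForm ρ s c 4 v =
      ((6 / Real.pi ^ 2 * (ρ ^ 4 / (s + ρ ^ 2) ^ 4) * (Matrix.of fun i j => v j i).det : ℝ) : ℂ) := by
  have h : ∀ (g w : ℂ) (A B C D : Matrix (Fin 2) (Fin 2) ℂ),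
      (A * (g • 1) * B * (w • 1) * (C * (g • 1) * D * (w • 1))).trace =
        (g * w) ^ 2 * (A * B * (C * D)).trace := by
    intro g w A B C D
    simp only [Matrix.smul_mul, Matrix.mul_smul, Matrix.mul_one, smul_smul,
      Matrix.trace_smul, smul_eq_mul]
    ring
  simp only [cornerForm, traceForm, Matrix.conjTranspose_conjTranspose, h]
  simp only [mul_left_comm _ ((_ * _) ^ 2), ← Finset.mul_sum, sum_sign_trace_quat_four]
  push_cast
  have : (Real.pi : ℂ) ≠ 0 := by exact_mod_cast Real.pi_ne_zero
  field_simp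
  ring

theorem cornerForm_eq_zero {n : ℕ} (h0 : n ≠ 0) (h4 : n ≠ 4) (ρ s : ℝ) (c : ℂ) (v : Fin n → R4) :
    cornerForm ρ s c n v = 0 := by
  match n with
  | 0 => exact absurd rfl h0
  | 1 => simp [cornerForm, traceForm]
  | 2 => exact cornerForm_two ρ s c v
  | 3 => simp [cornerForm, traceForm]
  | 4 => exact absurd rfl h4
  | _ + 5 => simp [cornerForm, traceForm]

/-! ### Nondegeneracy almost everywhere, and continuity in `x` -/

theorem continuous_adhmR {k : ℕ} (D : ADHMData k) :
    Continuous fun x : R4 => adhmR ((x, D) : ADHMTotal k) := by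
  refine continuous_matrix fun r c => ?_
  rcases c with c | c
  · simp only [adhmR, Matrix.fromCols_apply_inl, Matrix.conjTranspose_apply, Matrix.sum_apply,
      Matrix.kroneckerMap_apply, Matrix.sub_apply, Matrix.smul_apply, smul_eq_mul]
    fun_prop
  · change Continuous fun _ : R4 => ∑ i, D.2 i r.1 * quatUnit i r.2 c
    exact continuous_const

theorem isOpen_nondegenerateAt {k : ℕ} (D : ADHMData k) :
    IsOpen {x : R4 | NondegenerateAt ((x, D) : ADHMTotal k)} := by
  simp only [nondegenerateAt_iff_isUnit, Matrix.isUnit_iff_isUnit_det, isUnit_iff_ne_zero]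
  have h := continuous_adhmR D
  exact isOpen_ne_fun (h.matrix_mul h.matrix_conjTranspose).matrix_det continuous_const

/-- It suffices that `T - x` is invertible. On a line in the direction of `x₄` this matrix is
`A - t`, which is invertible unless `t` is one of the finitely many eigenvalues of `A`. -/
theorem ae_nondegenerateAt {k : ℕ} (D : ADHMData k) :
    ∀ᵐ x : R4, NondegenerateAt ((x, D) : ADHMTotal k) := by
  classical
  let L : ℝ →ₗ[ℝ] R4 := LinearMap.toSpanSingleton ℝ R4 (EuclideanSpace.single 3 1)
  refine ae_mem_of_ae_add_linearMap_mem L volume volume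
    (s := {x : R4 | NondegenerateAt ((x, D) : ADHMTotal k)})
    (isOpen_nondegenerateAt D).measurableSet fun y => ?_
  set A : Matrix (Fin k × Fin 2) (Fin k × Fin 2) ℂ :=
    ∑ i, ((D.1 i : Matrix (Fin k) (Fin k) ℂ) - ((y i : ℝ) : ℂ) • 1) ⊗ₖ quatUnit i with hA
  have hline : ∀ t : ℝ, ∑ i, ((D.1 i : Matrix (Fin k) (Fin k) ℂ) -
      (((y + L t) i : ℝ) : ℂ) • 1) ⊗ₖ quatUnit i = A - (t : ℂ) • 1 := fun t => by
    ext ⟨r, s⟩ ⟨c, u⟩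
    simp [hA, L, Fin.sum_univ_four, quatUnit, Matrix.one_apply]
    split_ifs <;> grind
  have hfin : {t : ℝ | (A.charpoly).IsRoot (t : ℂ)}.Finite :=
    (Polynomial.finite_setOfPred_isRoot A.charpoly_monic.ne_zero).preimage
      Complex.ofReal_injective.injOn
  refine ae_iff.2 (measure_mono_null (fun t ht => ?_) (hfin.measure_zero volume))
  by_contra hroot
  refine ht ?_
  have hdet : IsUnit (A - (t : ℂ) • 1).det := by
    refine isUnit_iff_ne_zero.2 fun h => hroot ?_
    have h' : (Matrix.scalar (Fin k × Fin 2) (t : ℂ) - A).det = 0 := by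
      rw [← neg_sub, Matrix.det_neg, Matrix.scalar_apply,
        ← Matrix.smul_one_eq_diagonal, h, mul_zero]
    simpa [Polynomial.IsRoot, Matrix.eval_charpoly] using h'
  have hunit : IsUnit (A - (t : ℂ) • 1).conjTranspose :=
    (Matrix.isUnit_conjTranspose _).2 ((Matrix.isUnit_iff_isUnit_det _).2 hdet)
  intro b
  obtain ⟨v, hv⟩ := Matrix.mulVec_surjective_iff_isUnit.2 hunit b
  refine ⟨Sum.elim v 0, ?_⟩
  rw [adhmR, Matrix.fromCols_mulVec_sumElim, Matrix.mulVec_zero, add_zero]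
  simp only [hline]
  exact hv

theorem continuous_greenOp {k : ℕ} (D : ADHMData k)
    (h : ∀ x : R4, NondegenerateAt ((x, D) : ADHMTotal k)) :
    Continuous fun x : R4 => greenOp 0 ((x, D) : ADHMTotal k) := by
  simp only [nondegenerateAt_iff_isUnit, Matrix.isUnit_iff_isUnit_det, isUnit_iff_ne_zero] at h
  have hR := continuous_adhmR D
  have hM := hR.matrix_mul hR.matrix_conjTranspose
  simp only [greenOp, Matrix.zero_kronecker, add_zero, Matrix.inv_def, Ring.inverse_eq_inv']
  exact (hM.matrix_det.inv₀ h).smul hM.matrix_adjugate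

theorem continuous_traceForm {X r c : Type*} [TopologicalSpace X] [Fintype r] [Fintype c]
    {G : X → Matrix r r ℂ} {W : X → Matrix c c ℂ} (hG : Continuous G) (hW : Continuous W)
    (L : Matrix c c ℂ) (n : ℕ) (A : Fin n → Matrix r c ℂ) :
    Continuous fun x => traceForm (G x) (W x) L n A := by
  match n with
  | 0 => simp only [traceForm]; fun_prop
  | 1 => exact continuous_const
  | 2 => simp only [traceForm]; fun_prop
  | 3 => exact continuous_const
  | 4 => simp only [traceForm]; fun_prop
  | _ + 5 => exact continuous_const

theorem continuous_chernForm {k : ℕ} (D : ADHMData k)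
    (h : ∀ x : R4, NondegenerateAt ((x, D) : ADHMTotal k)) (ξ : Matrix (Fin k) (Fin k) ℂ)
    (n : ℕ) (a : Fin n → ADHMTotal k) :
    Continuous fun x : R4 => chernForm ξ ((x, D) : ADHMTotal k) n a := by
  have hR := continuous_adhmR D
  have hG := continuous_greenOp D h
  simp only [chernForm, regChernForm_eq_traceForm]
  refine continuous_const.mul (continuous_traceForm hG ?_ _ _ _)
  exact continuous_const.sub ((hR.matrix_conjTranspose.matrix_mul hG).matrix_mul hR)

/-! ### The delta function -/

/-- In polar coordinates the integral is `2π² ∫ r³ (1 + r²)⁻⁴ dr = 2π² / 12`. -/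
theorem integral_bubble :
    ∫ x : R4, 6 / Real.pi ^ 2 * ((1 + ‖x‖ ^ 2) ^ 4)⁻¹ = 1 := by
  have hrad : ∫ y in Set.Ioi (0 : ℝ), y ^ 3 • (6 / Real.pi ^ 2 * ((1 + y ^ 2) ^ 4)⁻¹) =
      1 / (2 * Real.pi ^ 2) := by
    have hderiv : ∀ y ∈ Set.Ici (0 : ℝ), HasDerivAt
        (fun y : ℝ => 6 / Real.pi ^ 2 * (((1 + y ^ 2) ^ 3)⁻¹ / 6 - ((1 + y ^ 2) ^ 2)⁻¹ / 4))
        (y ^ 3 • (6 / Real.pi ^ 2 * ((1 + y ^ 2) ^ 4)⁻¹)) y := by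
      intro y _
      have h1 : HasDerivAt (fun y : ℝ => 1 + y ^ 2) (2 * y) y := by
        simpa using (hasDerivAt_pow 2 y).const_add 1
      have hne : 1 + y ^ 2 ≠ 0 := by positivity
      have h2 := ((((h1.pow 3).inv (pow_ne_zero 3 hne)).div_const 6).sub
        (((h1.pow 2).inv (pow_ne_zero 2 hne)).div_const 4)).const_mul (6 / Real.pi ^ 2)
      refine HasDerivAt.congr_deriv (by exact h2) ?_
      simp only [Pi.pow_apply, smul_eq_mul]
      field_simp
      ring
    have hlim : Tendsto
        (fun y : ℝ => 6 / Real.pi ^ 2 * (((1 + y ^ 2) ^ 3)⁻¹ / 6 - ((1 + y ^ 2) ^ 2)⁻¹ / 4))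
        atTop (𝓝 (6 / Real.pi ^ 2 * (0 / 6 - 0 / 4))) := by
      have h : Tendsto (fun y : ℝ => 1 + y ^ 2) atTop atTop :=
        tendsto_atTop_add_const_left _ _ (tendsto_pow_atTop two_ne_zero)
      exact ((((tendsto_pow_atTop three_ne_zero).comp h).inv_tendsto_atTop.div_const 6).sub
        (((tendsto_pow_atTop two_ne_zero).comp h).inv_tendsto_atTop.div_const 4)).const_mul _
    rw [integral_Ioi_of_hasDerivAt_of_nonneg' hderiv (fun y hy => ?_) hlim]
    · field_simp
      norm_num
    · have : 0 < y := hy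
      simp only [smul_eq_mul]
      positivity
  have hvol : (volume : Measure R4).real (Metric.ball 0 1) = Real.pi ^ 2 / 2 := by
    rw [Measure.real, EuclideanSpace.volume_ball]
    have hG : Real.Gamma ((4 : ℝ) / 2 + 1) = 2 := by
      rw [show (4 : ℝ) / 2 + 1 = (2 : ℕ) + 1 by norm_num, Real.Gamma_nat_eq_factorial]
      norm_num [Nat.factorial]
    have hs : √Real.pi ^ 4 = Real.pi ^ 2 := by
      rw [show (4 : ℕ) = 2 * 2 by rfl, pow_mul, Real.sq_sqrt Real.pi_nonneg]
    simp only [Fintype.card_fin, Nat.cast_ofNat, hG, hs, ENNReal.ofReal_one, one_pow, one_mul]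
    exact ENNReal.toReal_ofReal (by positivity)
  rw [integral_fun_norm_addHaar volume fun r : ℝ => 6 / Real.pi ^ 2 * ((1 + r ^ 2) ^ 4)⁻¹]
  rw [finrank_euclideanSpace, Fintype.card_fin, hrad, hvol]
  simp only [smul_eq_mul, nsmul_eq_mul]
  field_simp
  norm_num

/-- The functions `(6 / π²) ρ⁴ (|x - x₀|² + ρ²)⁻⁴` are the rescalings of a function of integral one,
hence an approximate identity at `x₀`. -/
theorem tendsto_integral_bubble {f : R4 → ℝ} (hf : Continuous f) (hc : HasCompactSupport f)
    (x₀ : R4) :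
    Tendsto (fun ρ : ℝ => ∫ x : R4,
      f x * (6 / Real.pi ^ 2 * (ρ ^ 4 / (‖x₀ - x‖ ^ 2 + ρ ^ 2) ^ 4))) (𝓝[>] 0) (𝓝 (f x₀)) := by
  have hdecay : Tendsto (fun x : R4 => ‖x‖ ^ Module.finrank ℝ R4 *
      (6 / Real.pi ^ 2 * ((1 + ‖x‖ ^ 2) ^ 4)⁻¹)) (Bornology.cobounded R4) (𝓝 0) := by
    have h1 : Tendsto (fun x : R4 => 6 / Real.pi ^ 2 * (‖x‖ ^ 4)⁻¹)
        (Bornology.cobounded R4) (𝓝 (6 / Real.pi ^ 2 * 0)) :=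
      ((tendsto_pow_atTop four_ne_zero).comp
        tendsto_norm_cobounded_atTop).inv_tendsto_atTop.const_mul _
    rw [mul_zero] at h1
    refine squeeze_zero (fun x => by positivity) (fun x => ?_) h1
    rw [finrank_euclideanSpace, Fintype.card_fin, mul_left_comm]
    refine mul_le_mul_of_nonneg_left ?_ (by positivity)
    rcases eq_or_ne x 0 with rfl | hx
    · simp
    have hx' : 0 < ‖x‖ := norm_pos_iff.2 hx
    rw [← div_eq_mul_inv, div_le_iff₀ (by positivity), inv_mul_eq_div, le_div_iff₀ (by positivity)]
    calc ‖x‖ ^ 4 * ‖x‖ ^ 4 = (‖x‖ ^ 2) ^ 4 := by ring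
      _ ≤ (1 + ‖x‖ ^ 2) ^ 4 := by gcongr; linarith
  have hmain := (tendsto_integral_comp_smul_smul_of_integrable' (μ := (volume : Measure R4))
    (φ := fun x => 6 / Real.pi ^ 2 * ((1 + ‖x‖ ^ 2) ^ 4)⁻¹)
    (fun x => by positivity) integral_bubble hdecay
    (hf.integrable_of_hasCompactSupport hc) (hf.continuousAt (x := x₀))).comp
    (tendsto_inv_nhdsGT_zero (𝕜 := ℝ))
  refine hmain.congr' ?_
  filter_upwards [self_mem_nhdsWithin] with ρ hρ
  have hρ' : (0 : ℝ) < ρ := hρ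
  simp only [Function.comp_apply]
  refine integral_congr_ae (Eventually.of_forall fun x => ?_)
  simp only [finrank_euclideanSpace, Fintype.card_fin, norm_smul, smul_eq_mul, norm_inv,
    Real.norm_eq_abs, abs_of_pos hρ']
  have hs : ‖x₀ - x‖ ^ 2 + ρ ^ 2 ≠ 0 := by positivity
  have hs' : 1 + (ρ⁻¹ * ‖x₀ - x‖) ^ 2 = (‖x₀ - x‖ ^ 2 + ρ ^ 2) / ρ ^ 2 := by
    field_simp
    ring
  rw [hs']
  field_simp

theorem continuousAt_sq_ratio {s ρ : ℝ} (hs : s + ρ ^ 2 ≠ 0) :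
    ContinuousAt (fun ρ : ℝ => ρ ^ 2 / (s + ρ ^ 2)) ρ :=
  ContinuousAt.div (by fun_prop) (by fun_prop) hs

/-- In degree `0` the regularising term is bounded and tends to zero off `x₀`. -/
theorem tendsto_integral_sq_ratio {f : R4 → ℝ} (hf : Continuous f) (hc : HasCompactSupport f)
    (x₀ : R4) :
    Tendsto (fun ρ : ℝ => ∫ x : R4,
      f x * (ρ ^ 2 / (‖x₀ - x‖ ^ 2 + ρ ^ 2)) ^ 2) (𝓝[>] 0) (𝓝 0) := by
  have hne : ∀ᵐ x : R4, x ≠ x₀ := by simp [ae_iff]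
  suffices h : Tendsto (fun ρ : ℝ => ∫ x : R4, f x * (ρ ^ 2 / (‖x₀ - x‖ ^ 2 + ρ ^ 2)) ^ 2)
      (𝓝[>] 0) (𝓝 (∫ _ : R4, (0 : ℝ))) by simpa using h
  refine tendsto_integral_filter_of_dominated_convergence (fun x => |f x|) ?_ ?_
    (hf.integrable_of_hasCompactSupport hc).abs ?_
  · filter_upwards [self_mem_nhdsWithin] with ρ hρ
    have hρ' : (0 : ℝ) < ρ := hρ
    refine Continuous.aestronglyMeasurable (hf.mul ((continuous_const.div (by fun_prop)
      fun x => ?_).pow 2))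
    positivity
  · filter_upwards [self_mem_nhdsWithin] with ρ hρ
    have hρ' : (0 : ℝ) < ρ := hρ
    refine Eventually.of_forall fun x => ?_
    rw [Real.norm_eq_abs, abs_mul]
    refine mul_le_of_le_one_right (abs_nonneg _) ?_
    rw [abs_of_nonneg (by positivity)]
    refine pow_le_one₀ (by positivity) ((div_le_one (by positivity)).2 ?_)
    nlinarith [sq_nonneg ‖x₀ - x‖]
  · filter_upwards [hne] with x hx
    have hs : ‖x₀ - x‖ ^ 2 + (0 : ℝ) ^ 2 ≠ 0 := by
      simpa [sub_eq_zero] using hx.symm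
    have hcont : ContinuousAt (fun ρ : ℝ => f x * (ρ ^ 2 / (‖x₀ - x‖ ^ 2 + ρ ^ 2)) ^ 2) 0 := by
      exact continuousAt_const.mul ((continuousAt_sq_ratio hs).pow 2)
    have := hcont.tendsto.mono_left (nhdsWithin_le_nhds (s := Set.Ioi 0))
    simpa using this

theorem continuousAt_cornerForm {s : ℝ} (ρ : ℝ) (hs : s + ρ ^ 2 ≠ 0) (c : ℂ) (n : ℕ)
    (v : Fin n → R4) : ContinuousAt (fun ρ : ℝ => cornerForm ρ s c n v) ρ := by
  rcases eq_or_ne n 0 with rfl | h0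
  · simp only [cornerForm_zero]
    refine continuousAt_const.mul (Complex.continuous_ofReal.continuousAt.comp ?_)
    exact (continuousAt_sq_ratio hs).pow 2
  rcases eq_or_ne n 4 with rfl | h4
  · simp only [cornerForm_four]
    refine Complex.continuous_ofReal.continuousAt.comp ((continuousAt_const.mul ?_).mul
      continuousAt_const)
    exact ContinuousAt.div (by fun_prop) (by fun_prop) (pow_ne_zero 4 hs)
  · simp only [cornerForm_eq_zero h0 h4]
    exact continuousAt_const

/-- Without regularisation the block of `T₀` does not contribute: `ker (T₀ - x)^* = 0` for
`x ≠ T₀`. -/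
theorem cornerForm_zero_left (s : ℝ) (c : ℂ) (n : ℕ) (v : Fin n → R4) :
    cornerForm 0 s c n v = 0 := by
  rcases eq_or_ne n 0 with rfl | h0
  · simp [cornerForm_zero]
  rcases eq_or_ne n 4 with rfl | h4
  · simp [cornerForm_four]
  · exact cornerForm_eq_zero h0 h4 _ _ _ _

theorem continuous_cornerForm {ρ : ℝ} (hρ : 0 < ρ) (x₀ : R4) (c : ℂ) (n : ℕ) (v : Fin n → R4) :
    Continuous fun x : R4 => cornerForm ρ (‖x₀ - x‖ ^ 2) c n v := by
  rcases eq_or_ne n 0 with rfl | h0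
  · simp only [cornerForm_zero]
    refine continuous_const.mul (Complex.continuous_ofReal.comp
      ((continuous_const.div (by fun_prop) fun x => ?_).pow 2))
    positivity
  rcases eq_or_ne n 4 with rfl | h4
  · simp only [cornerForm_four]
    refine Complex.continuous_ofReal.comp
      ((continuous_const.mul (continuous_const.div (by fun_prop) fun x => ?_)).mul
        continuous_const)
    positivity
  · simp only [cornerForm_eq_zero h0 h4]
    exact continuous_const

theorem tendsto_integral_cornerForm {m : ℕ} {f : R4 → ℝ} (hf : Continuous f)
    (hc : HasCompactSupport f) (x₀ : R4) (c : ℂ) (n : ℕ) (a : Fin n → ADHMTotal (m + 1)) :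
    Tendsto (fun ρ : ℝ => ∫ x : R4, (f x : ℂ) *
      cornerForm ρ (‖x₀ - x‖ ^ 2) c n (fun i => cornerT (a i).2 - (a i).1)) (𝓝[>] 0)
      (𝓝 ((f x₀ : ℂ) * (volForm n a : ℂ))) := by
  rcases eq_or_ne n 0 with rfl | h0
  · have h := ((Complex.continuous_ofReal.tendsto _).comp
      (tendsto_integral_sq_ratio hf hc x₀)).const_mul (1 / (4 * (Real.pi : ℂ) ^ 2) * c ^ 2)
    simp only [cornerForm_zero, volForm]
    refine (h.congr fun ρ => ?_).trans_eq ?_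
    · rw [Function.comp_apply, ← integral_complex_ofReal, ← integral_const_mul]
      refine integral_congr_ae (Eventually.of_forall fun x => ?_)
      push_cast
      ring
    · simp
  rcases eq_or_ne n 4 with rfl | h4
  · have h := ((Complex.continuous_ofReal.tendsto _).comp
      (tendsto_integral_bubble hf hc x₀)).mul_const ((volForm 4 a : ℝ) : ℂ)
    -- `volForm` is expressed through `x - T₀`; in even degree the sign does not matter.
    have hdet : (Matrix.of fun i j : Fin 4 => (cornerT (a j).2 - (a j).1) i).det = volForm 4 a := by
      rw [volForm, show (Matrix.of fun i j : Fin 4 => (cornerT (a j).2 - (a j).1) i) =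
        -(Matrix.of fun i j : Fin 4 => ((a j).1 - cornerT (a j).2) i) by ext; simp, Matrix.det_neg]
      norm_num
    simp only [cornerForm_four, hdet]
    refine h.congr fun ρ => ?_
    rw [Function.comp_apply, ← integral_complex_ofReal, ← integral_mul_const]
    refine integral_congr_ae (Eventually.of_forall fun x => ?_)
    push_cast
    ring
  · have hv : volForm n a = 0 := by
      match n with
      | 0 => exact absurd rfl h0
      | 1 | 2 | 3 => rfl
      | 4 => exact absurd rfl h4
      | _ + 5 => rfl
    simp [cornerForm_eq_zero h0 h4, hv]

/-! ### The Chern form along `Sing_1` -/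

theorem mainTheorem6 (m : ℕ) (D : ADHMData (m + 1)) (hD : D ∈ sing1 m)
    (ξ : Matrix (Fin (m + 1)) (Fin (m + 1)) ℂ) (hξ : ξ ∈ lieTorus (m + 1))
    (n : ℕ) (a : Fin n → ADHMTotal (m + 1)) (ha : ∀ i, (a i).2 ∈ sing1 m) :
    (∀ x : R4, x ≠ cornerT D → NondegenerateAt (x, tailData D) →
      NondegenerateAt (x, D) ∧
      chernForm ξ (x, D) n a =
        chernForm (ξ.submatrix Fin.succ Fin.succ) (x, tailData D) n (fun i => tailTotal (a i)) ∧
      Tendsto (fun ρ : ℝ => chernFormReg ρ ξ (x, D) n a) (𝓝[>] 0) (𝓝 (chernForm ξ (x, D) n a))) ∧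
    ((∀ x : R4, NondegenerateAt (x, tailData D)) →
      LocallyIntegrable (fun x : R4 => chernForm (ξ.submatrix Fin.succ Fin.succ)
        (x, tailData D) n (fun i => tailTotal (a i))) volume) ∧
    ∀ f : R4 → ℝ, ContDiff ℝ ∞ f → HasCompactSupport f →
      Integrable (fun x : R4 => (f x : ℂ) * chernForm (ξ.submatrix Fin.succ Fin.succ)
        (x, tailData D) n (fun i => tailTotal (a i))) volume →
      (∀ ρ : ℝ, 0 < ρ →
        Integrable (fun x : R4 => (f x : ℂ) * chernFormReg ρ ξ (x, D) n a) volume) ∧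
      Tendsto (fun ρ : ℝ => ∫ x : R4, (f x : ℂ) * chernFormReg ρ ξ (x, D) n a) (𝓝[>] 0)
        (𝓝 ((∫ x : R4, (f x : ℂ) * chernForm (ξ.submatrix Fin.succ Fin.succ)
          (x, tailData D) n (fun i => tailTotal (a i))) +
          (f (cornerT D) : ℂ) * (volForm n a : ℂ))) := by
  have key : ∀ (x : R4) (ρ : ℝ), NondegenerateAt (x, tailData D) →
      ‖cornerT D - x‖ ^ 2 + ρ ^ 2 ≠ 0 → chernFormReg ρ ξ (x, D) n a =
        cornerForm ρ (‖cornerT D - x‖ ^ 2) (ξ 0 0) n (fun i => cornerT (a i).2 - (a i).1) +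
        chernForm (ξ.submatrix Fin.succ Fin.succ) (x, tailData D) n (fun i => tailTotal (a i)) :=
    fun x ρ hx hs => chernFormReg_eq_cornerForm_add (x, D) hD ρ hs hx ξ hξ.1 n a ha
  refine ⟨fun x hx hnd => ?_, fun hnd => ?_, fun f hf hc hint => ?_⟩
  · have hs : 0 < ‖cornerT D - x‖ ^ 2 := by
      have := norm_pos_iff.2 (sub_ne_zero.2 hx.symm)
      positivity
    have heq : chernForm ξ (x, D) n a = chernForm (ξ.submatrix Fin.succ Fin.succ)
        (x, tailData D) n (fun i => tailTotal (a i)) := by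
      have h := key x 0 hnd (by positivity)
      rw [cornerForm_zero_left, zero_add] at h
      rw [← h]
      simp [chernForm, chernFormReg]
    refine ⟨NondegenerateAt.of_tail hD hx hnd, heq, ?_⟩
    have hlim := (continuousAt_cornerForm 0 (s := ‖cornerT D - x‖ ^ 2) (by positivity) (ξ 0 0) n
      (fun i => cornerT (a i).2 - (a i).1)).tendsto.mono_left
        (nhdsWithin_le_nhds (s := Set.Ioi 0))
    rw [cornerForm_zero_left] at hlim
    have hlim' := hlim.add_const (chernForm (ξ.submatrix Fin.succ Fin.succ)
        (x, tailData D) n (fun i => tailTotal (a i)))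
    rw [zero_add, ← heq] at hlim'
    refine hlim'.congr fun ρ => ?_
    rw [key x ρ hnd (by positivity), heq]
  · exact (continuous_chernForm _ hnd _ _ _).locallyIntegrable
  · have hcorner : ∀ ρ : ℝ, 0 < ρ → Integrable (fun x : R4 => (f x : ℂ) *
        cornerForm ρ (‖cornerT D - x‖ ^ 2) (ξ 0 0) n (fun i => cornerT (a i).2 - (a i).1)) :=
      fun ρ hρ => ((Complex.continuous_ofReal.comp hf.continuous).mul
        (continuous_cornerForm hρ _ _ _ _)).integrable_of_hasCompactSupport
          (HasCompactSupport.mul_right (hc.comp_left Complex.ofReal_zero))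
    have hae : ∀ ρ : ℝ, 0 < ρ → (fun x : R4 => (f x : ℂ) * chernFormReg ρ ξ (x, D) n a) =ᵐ[volume]
        fun x => (f x : ℂ) * cornerForm ρ (‖cornerT D - x‖ ^ 2) (ξ 0 0) n
            (fun i => cornerT (a i).2 - (a i).1) +
          (f x : ℂ) * chernForm (ξ.submatrix Fin.succ Fin.succ) (x, tailData D) n
            (fun i => tailTotal (a i)) := fun ρ hρ => by
      filter_upwards [ae_nondegenerateAt (tailData D)] with x hx
      rw [key x ρ hx (by positivity), mul_add]
    refine ⟨fun ρ hρ => ((hcorner ρ hρ).add hint).congr (hae ρ hρ).symm, ?_⟩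
    rw [add_comm (∫ x : R4, _)]
    refine ((tendsto_integral_cornerForm hf.continuous hc (cornerT D) (ξ 0 0) n a).add_const
      (∫ x : R4, (f x : ℂ) * chernForm (ξ.submatrix Fin.succ Fin.succ)
          (x, tailData D) n (fun i => tailTotal (a i)))).congr' ?_
    filter_upwards [self_mem_nhdsWithin] with ρ hρ
    rw [integral_congr_ae (hae ρ hρ), integral_add (hcorner ρ hρ) hint]
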